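/- Let $\{|k\rangle : k\in\mathbb{Z}\}$ be the standard orthonormal basis of $\ell^2(\mathbb{Z})$, let $H$ be the adjacency operator of the line, $H|k\rangle = |k+1\rangle + |k-1\rangle$, and let $L_S=\sum_{i\in\mathbb{Z}}\left(\tfrac12|i\rangle\langle i+1|+\tfrac12|i+1\rangle\langle i|\right)$ (strongly convergent sum) be the global dissipation operator. Let $\omega\in[0,1]$. The stochastic quantum walk on the line with global dissipation, started at $|0\rangle$, is the family $\rho(t)$, $t\ge 0$, of bounded operators on $\ell^2(\mathbb{Z})$ with $$\dot\rho = -\mathrm{i}(1-\omega)[H,\rho]+\omega\left(L_S\,\rho\, L_S^\dagger-\tfrac12\{L_S^\dagger L_S,\rho\}\right),\qquad \rho(0)=|0\rangle\langle 0|,$$ where the derivative is taken in operator norm (one-sided at $t=0$). Such a $\rho$ exists, and for every such $\rho$, all $t\ge 0$ and all $k\in\mathbb{Z}$, $$\langle k|\rho(t)|k\rangle=\frac{1}{4\pi^2}\int_{-\pi}^{\pi}\int_{-\pi}^{\pi}\cos(kx)\cos(ky)\,\exp\!\left[-\omega\tfrac{t}{2}(\cos x-\cos y)^2\right]\exp\!\left[2\mathrm{i}t(1-\omega)(\cos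 x-\cos y)\right]\mathrm{d}x\,\mathrm{d}y .$$ -/

import Mathlib

open scoped InnerProductSpace

noncomputable section

namespace StochasticWalk

/-- The master equation. For bounded operators `H` and `L` on a complex Hilbert space, the
right-hand side of the GKSL equation with Hamiltonian `H`, a single Lindblad operator `L` and
mixing parameter `ω`:
`-i (1-ω) [H, ρ] + ω (L ρ L† - ½ {L† L, ρ})`. -/
def gksl {E : Type*} [NormedAddCommGroup E] [InnerProductSpace ℂ E] [CompleteSpace E]
    (H L : E →L[ℂ] E) (ω : ℝ) (ρ : E →L[ℂ] E) : E →L[ℂ] E :=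
  (-Complex.I * (1 - (ω : ℂ))) • (H * ρ - ρ * H)
    + (ω : ℂ) • (L * ρ * ContinuousLinearMap.adjoint L
        - (1 / 2 : ℂ) • (ContinuousLinearMap.adjoint L * L * ρ
            + ρ * (ContinuousLinearMap.adjoint L * L)))

/-- `ρ` solves the GKSL equation at all times `t ≥ 0` (one-sided derivative at `t = 0`),
with respect to the operator norm. -/
def IsGKSLSolution {E : Type*} [NormedAddCommGroup E] [InnerProductSpace ℂ E] [CompleteSpace E]
    (H L : E →L[ℂ] E) (ω : ℝ) (ρ : ℝ → E →L[ℂ] E) : Prop :=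
  ∀ t : ℝ, 0 ≤ t → HasDerivWithinAt ρ (gksl H L ω (ρ t)) (Set.Ici 0) t

/-- The Hilbert space `ℓ²(ℤ)` of the walk on the line. -/
abbrev LineSpace : Type := lp (fun _ : ℤ => ℂ) 2

/-- The position state `|k⟩`. -/
def ket (k : ℤ) : LineSpace := lp.single 2 k (1 : ℂ)

/-- The operator `|u⟩⟨v|`. -/
abbrev ketbra (u v : LineSpace) : LineSpace →L[ℂ] LineSpace := InnerProductSpace.rankOne ℂ u v

theorem memℓp_shift (d : ℤ) (f : LineSpace) :
    Memℓp (fun i : ℤ => (f : ∀ _ : ℤ, ℂ) (i - d)) 2 := by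
  have hf := (memℓp_gen_iff (p := 2) (by norm_num)).1 (lp.memℓp f)
  refine (memℓp_gen_iff (p := 2) (by norm_num)).2 ?_
  exact hf.comp_injective (sub_left_injective (b := d))

/-- The translation by `d`, `|k⟩ ↦ |k + d⟩`, as an isometry of `ℓ²(ℤ)`. -/
def shift (d : ℤ) : LineSpace →ₗᵢ[ℂ] LineSpace where
  toFun f := ⟨fun i : ℤ => (f : ∀ _ : ℤ, ℂ) (i - d), memℓp_shift d f⟩
  map_add' _ _ := rfl
  map_smul' _ _ := rfl
  norm_map' f := by
    rw [lp.norm_eq_tsum_rpow (by norm_num), lp.norm_eq_tsum_rpow (by norm_num)]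
    congr 1
    exact (Equiv.subRight d).tsum_eq
      (fun i : ℤ => ‖(f : ∀ _ : ℤ, ℂ) i‖ ^ (2 : ENNReal).toReal)

/-- The adjacency operator of the line, the Hamiltonian of the walk:
`|k⟩ ↦ |k + 1⟩ + |k - 1⟩`. -/
def lineHamiltonian : LineSpace →L[ℂ] LineSpace :=
  (shift 1).toContinuousLinearMap + (shift (-1)).toContinuousLinearMap

/-- The global dissipation operator `L_S = ∑ᵢ (½ |i⟩⟨i+1| + ½ |i+1⟩⟨i|)` of the line. -/
def lineDissipator : LineSpace →L[ℂ] LineSpace :=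
  (1 / 2 : ℂ) • (shift 1).toContinuousLinearMap
    + (1 / 2 : ℂ) • (shift (-1)).toContinuousLinearMap

/-- `ρ` is the evolution of the stochastic quantum walk on the line with global dissipation,
started from `|0⟩⟨0|`. -/
structure IsLineWalk (ω : ℝ) (ρ : ℝ → LineSpace →L[ℂ] LineSpace) : Prop where
  initial : ρ 0 = ketbra (ket 0) (ket 0)
  evolution : IsGKSLSolution lineHamiltonian lineDissipator ω ρ

theorem shift_ket (d k : ℤ) : shift d (ket k) = ket (k + d) := by
  ext i
  change (ket k : ∀ _ : ℤ, ℂ) (i - d) = _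
  simp only [ket, lp.coeFn_single, Pi.single_apply, sub_eq_iff_eq_add]

theorem inner_ket_ket (i j : ℤ) : ⟪ket i, ket j⟫_ℂ = if i = j then 1 else 0 := by
  simp [ket, lp.inner_single_left, Pi.single_apply]

/-- The matrix elements of the Hamiltonian are those of the adjacency matrix of the line. -/
theorem inner_lineHamiltonian (i j : ℤ) :
    ⟪ket i, lineHamiltonian (ket j)⟫_ℂ = if i = j + 1 ∨ j = i + 1 then 1 else 0 := by
  simp only [lineHamiltonian, add_apply, LinearIsometry.coe_toContinuousLinearMap,
    shift_ket, inner_add_right, inner_ket_ket]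
  grind

/-- `L_S` is the (strongly convergent) sum of the local operators `½ |i⟩⟨i+1|` and
`½ |i+1⟩⟨i|`. -/
theorem hasSum_lineDissipator (v : LineSpace) :
    HasSum (fun i : ℤ => ((1 / 2 : ℂ) • ketbra (ket i) (ket (i + 1))) v
      + ((1 / 2 : ℂ) • ketbra (ket (i + 1)) (ket i)) v) (lineDissipator v) := by
  have hv : HasSum (fun i : ℤ => ⟪ket i, v⟫_ℂ • ket i) v := by
    have h := lp.hasSum_single (p := 2) (by norm_num) v
    refine h.congr_fun ?_
    intro i
    simp [ket, lp.inner_single_left, ← lp.single_smul]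
  have h1 := ((shift 1).toContinuousLinearMap.hasSum hv).const_smul (1 / 2 : ℂ)
  have h2 := ((shift (-1)).toContinuousLinearMap.hasSum hv).const_smul (1 / 2 : ℂ)
  have h3 := (Equiv.addRight (1 : ℤ)).hasSum_iff.2 h2
  have h4 := h3.add h1
  rw [lineDissipator, add_comm]
  convert h4 using 2 with i
  · simp [shift_ket]
  · rfl

end StochasticWalk

end

/-! In the Fourier representation the adjacency operator of the line is multiplication by `2 cos`
and the global dissipator is multiplication by `cos`. Both therefore generate, by multiplication
from the left and from the right, commuting maps on the bounded operators, and the generator of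
the master equation becomes multiplication by the function
`g (y, x) = 2 i (1 - ω) (cos x - cos y) - (ω / 2) (cos x - cos y) ^ 2`,
where `y` belongs to the row index and `x` to the column index.

To keep everything at the level of matrix elements, an operator `A` is said to have the cosine
symbol `f` if `⟨j|A|k⟩ = (1 / 4π²) ∬ cos (j y) cos (k x) f (y, x)`. The identity
`cos ((j + 1) y) + cos ((j - 1) y) = 2 cos y cos (j y)` turns multiplication of operators by the
dissipator into multiplication of symbols by a cosine
(`HasSymbol.dissipator_mul`, `HasSymbol.mul_dissipator`), and `|0⟩⟨0|` has the symbol `1` by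
orthogonality. The master equation is linear with a bounded generator (`gkslGenerator`), so its
solution is unique and given by the exponential series (`IsGKSLSolution.eq_linearFlow`). The
`n`-th power of the generator maps the initial state to an operator with symbol `g ^ n`, and summing under the
integral sign shows that the state at time `t` has the symbol `exp (t g)`
(`HasSymbol.linearFlow`). -/

open MeasureTheory Set
open scoped InnerProductSpace Nat

noncomputable section

namespace StochasticWalk

/-! ### Linear flows and uniqueness for the master equation -/

section Flow

variable {F : Type*} [NormedAddCommGroup F] [NormedSpace ℂ F]

/-- The solution `exp (t T) x` at time `t` of the linear equation `u' = T u`, `u 0 = x`, with a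
bounded operator `T` on a Banach space. -/
def linearFlow (T : F →L[ℂ] F) (t : ℝ) (x : F) : F := NormedSpace.exp ((t : ℂ) • T) x

theorem linearFlow_zero (T : F →L[ℂ] F) (x : F) : linearFlow T 0 x = x := by
  simp [linearFlow]

theorem hasDerivAt_linearFlow [CompleteSpace F] (T : F →L[ℂ] F) (x : F) (t : ℝ) :
    HasDerivAt (fun t => linearFlow T t x) (T (linearFlow T t x)) t := by
  have h := hasDerivAt_exp_smul_const' (𝕂 := ℂ) T (t : ℂ)
  have h2 := ((ContinuousLinearMap.apply ℂ F x).hasFDerivAt.comp_hasDerivAt (t : ℂ) h).scomp t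
    Complex.ofRealCLM.hasDerivAt
  rwa [Complex.ofRealCLM_apply, Complex.ofReal_one, one_smul] at h2

theorem hasSum_linearFlow [CompleteSpace F] (T : F →L[ℂ] F) (t : ℝ) (x : F) :
    HasSum (fun n : ℕ => (n ! : ℂ)⁻¹ • ((t : ℂ) ^ n • (T ^ n) x)) (linearFlow T t x) := by
  have h := (ContinuousLinearMap.apply ℂ F x).hasSum
    (NormedSpace.exp_series_hasSum_exp' (𝕂 := ℂ) ((t : ℂ) • T))
  refine h.congr_fun fun n => ?_
  rw [smul_pow]
  rfl

end Flow

section Generator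

variable {E : Type*} [NormedAddCommGroup E] [InnerProductSpace ℂ E] [CompleteSpace E]

/-- The right-hand side of the master equation as a bounded linear map on the bounded
operators. -/
def gkslGenerator (H L : E →L[ℂ] E) (ω : ℝ) : (E →L[ℂ] E) →L[ℂ] (E →L[ℂ] E) :=
  (-Complex.I * (1 - (ω : ℂ))) •
      (ContinuousLinearMap.mul ℂ _ H - (ContinuousLinearMap.mul ℂ (E →L[ℂ] E)).flip H)
    + (ω : ℂ) • (ContinuousLinearMap.mulLeftRight ℂ _ L (ContinuousLinearMap.adjoint L)
        - (1 / 2 : ℂ) • (ContinuousLinearMap.mul ℂ _ (ContinuousLinearMap.adjoint L * L)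
            + (ContinuousLinearMap.mul ℂ (E →L[ℂ] E)).flip (ContinuousLinearMap.adjoint L * L)))

theorem gkslGenerator_apply (H L : E →L[ℂ] E) (ω : ℝ) (ρ : E →L[ℂ] E) :
    gkslGenerator H L ω ρ = gksl H L ω ρ := rfl

theorem isGKSLSolution_linearFlow (H L : E →L[ℂ] E) (ω : ℝ) (ρ₀ : E →L[ℂ] E) :
    IsGKSLSolution H L ω fun t => linearFlow (gkslGenerator H L ω) t ρ₀ :=
  fun t _ => (hasDerivAt_linearFlow _ ρ₀ t).hasDerivWithinAt

/-- The master equation has only one solution with a given initial value, by Grönwall's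
inequality. -/
theorem IsGKSLSolution.eq_linearFlow {H L : E →L[ℂ] E} {ω : ℝ} {ρ : ℝ → E →L[ℂ] E}
    (hρ : IsGKSLSolution H L ω ρ) {t : ℝ} (ht : 0 ≤ t) :
    ρ t = linearFlow (gkslGenerator H L ω) t (ρ 0) := by
  have hσ := isGKSLSolution_linearFlow H L ω (ρ 0)
  refine ODE_solution_unique_of_mem_Icc_right (v := fun _ => gkslGenerator H L ω)
    (s := fun _ => univ) (a := 0) (b := t) (K := ‖gkslGenerator H L ω‖₊)
    (fun _ _ => (gkslGenerator H L ω).lipschitz.lipschitzOnWith)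
    (fun s hs => ((hρ s hs.1).continuousWithinAt).mono Icc_subset_Ici_self)
    (fun s hs => (hρ s hs.1).mono (Ici_subset_Ici.2 hs.1)) (fun _ _ => mem_univ _)
    (fun s hs => ((hσ s hs.1).continuousWithinAt).mono Icc_subset_Ici_self)
    (fun s hs => (hσ s hs.1).mono (Ici_subset_Ici.2 hs.1)) (fun _ _ => mem_univ _)
    ?_ ⟨ht, le_rfl⟩
  exact (linearFlow_zero _ _).symm

end Generator

/-! ### The operators of the line -/

theorem inner_ket_left (k : ℤ) (v : LineSpace) : ⟪ket k, v⟫_ℂ = (v : ∀ _ : ℤ, ℂ) k := by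
  simp [ket, lp.inner_single_left]

theorem inner_ket_shift (d k : ℤ) (v : LineSpace) :
    ⟪ket k, shift d v⟫_ℂ = ⟪ket (k - d), v⟫_ℂ := by
  rw [inner_ket_left, inner_ket_left]
  rfl

theorem inner_shift_left (d : ℤ) (u v : LineSpace) :
    ⟪shift d u, v⟫_ℂ = ⟪u, shift (-d) v⟫_ℂ := by
  have h : shift d (shift (-d) v) = v := by
    ext i
    change (v : ∀ _ : ℤ, ℂ) (i - d - -d) = _
    simp
  conv_lhs => rw [← h]
  exact (shift d).inner_map_map _ _

theorem adjoint_lineDissipator : ContinuousLinearMap.adjoint lineDissipator = lineDissipator := by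
  symm
  rw [ContinuousLinearMap.eq_adjoint_iff]
  intro u v
  simp only [lineDissipator, add_apply, smul_apply, LinearIsometry.coe_toContinuousLinearMap,
    inner_add_left, inner_add_right, inner_smul_left, inner_smul_right, inner_shift_left]
  simp [add_comm, map_ofNat]

theorem lineHamiltonian_eq_smul : lineHamiltonian = (2 : ℂ) • lineDissipator := by
  simp [lineHamiltonian, lineDissipator, smul_smul]

theorem inner_ket_lineDissipator (j : ℤ) (v : LineSpace) :
    ⟪ket j, lineDissipator v⟫_ℂ = 1 / 2 * (⟪ket (j + 1), v⟫_ℂ + ⟪ket (j - 1), v⟫_ℂ) := by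
  simp only [lineDissipator, add_apply, smul_apply, LinearIsometry.coe_toContinuousLinearMap,
    inner_add_right, inner_smul_right, inner_ket_shift, sub_neg_eq_add]
  ring

theorem lineDissipator_ket (k : ℤ) :
    lineDissipator (ket k) = (1 / 2 : ℂ) • (ket (k + 1) + ket (k - 1)) := by
  simp [lineDissipator, shift_ket, sub_eq_add_neg]

/-! ### Cosine coefficients -/

/-- The square `(-π, π] × (-π, π]`. -/
def square : Set (ℝ × ℝ) := Ioc (-Real.pi) Real.pi ×ˢ Ioc (-Real.pi) Real.pi

theorem _root_.Continuous.integrableOn_square {F : Type*} [NormedAddCommGroup F]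
    {f : ℝ × ℝ → F} (hf : Continuous f) :
    IntegrableOn f square :=
  (hf.continuousOn.integrableOn_compact (isCompact_Icc.prod isCompact_Icc)).mono_set
    (prod_mono Ioc_subset_Icc_self Ioc_subset_Icc_self)

/-- The product of cosines against which the `(j, k)` matrix element is computed; the first
variable belongs to the row, the second to the column. -/
def cosCos (j k : ℤ) (z : ℝ × ℝ) : ℂ := (Real.cos (j * z.1) : ℂ) * (Real.cos (k * z.2) : ℂ)

@[fun_prop]
theorem continuous_cosCos (j k : ℤ) : Continuous (cosCos j k) := by
  unfold cosCos
  fun_prop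

/-- The normalised cosine coefficient of `f` on the square. -/
def cosCoeff (j k : ℤ) (f : ℝ × ℝ → ℂ) : ℂ :=
  1 / (4 * (Real.pi : ℂ) ^ 2) * ∫ z in square, cosCos j k z * f z

theorem cosCoeff_add {f g : ℝ × ℝ → ℂ} (hf : Continuous f) (hg : Continuous g) (j k : ℤ) :
    cosCoeff j k (f + g) = cosCoeff j k f + cosCoeff j k g := by
  simp only [cosCoeff, Pi.add_apply, mul_add]
  rw [integral_add (Continuous.integrableOn_square (by fun_prop))
    (Continuous.integrableOn_square (by fun_prop)), mul_add]

theorem cosCoeff_smul (c : ℂ) (f : ℝ × ℝ → ℂ) (j k : ℤ) :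
    cosCoeff j k (c • f) = c * cosCoeff j k f := by
  simp only [cosCoeff, Pi.smul_apply, smul_eq_mul, mul_left_comm _ c, integral_const_mul]

theorem cos_add_cos_int (j : ℤ) (y : ℝ) :
    Real.cos (((j + 1 : ℤ) : ℝ) * y) + Real.cos (((j - 1 : ℤ) : ℝ) * y)
      = 2 * (Real.cos (j * y) * Real.cos y) := by
  push_cast
  rw [add_mul, sub_mul, one_mul, Real.cos_add, Real.cos_sub]
  ring

/-- Averaging the coefficients of the neighbouring rows, as multiplication by the dissipator from
the left does, multiplies the function by the cosine of the row variable. -/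
theorem cosCoeff_row {f : ℝ × ℝ → ℂ} (hf : Continuous f) (j k : ℤ) :
    1 / 2 * (cosCoeff (j + 1) k f + cosCoeff (j - 1) k f)
      = cosCoeff j k fun z => (Real.cos z.1 : ℂ) * f z := by
  simp only [cosCoeff]
  rw [← mul_add, ← integral_add (Continuous.integrableOn_square (by fun_prop))
    (Continuous.integrableOn_square (by fun_prop)), mul_left_comm, ← integral_const_mul]
  congr 2 with z
  have h : (_ : ℂ) = _ := congrArg Complex.ofReal (cos_add_cos_int j z.1)
  simp only [Complex.ofReal_add, Complex.ofReal_mul, Complex.ofReal_ofNat] at h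
  simp only [cosCos]
  linear_combination (1 / 2 * (Real.cos (k * z.2) : ℂ) * f z) * h

theorem cosCoeff_column {f : ℝ × ℝ → ℂ} (hf : Continuous f) (j k : ℤ) :
    1 / 2 * (cosCoeff j (k + 1) f + cosCoeff j (k - 1) f)
      = cosCoeff j k fun z => (Real.cos z.2 : ℂ) * f z := by
  simp only [cosCoeff]
  rw [← mul_add, ← integral_add (Continuous.integrableOn_square (by fun_prop))
    (Continuous.integrableOn_square (by fun_prop)), mul_left_comm, ← integral_const_mul]
  congr 2 with z
  have h : (_ : ℂ) = _ := congrArg Complex.ofReal (cos_add_cos_int k z.2)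
  simp only [Complex.ofReal_add, Complex.ofReal_mul, Complex.ofReal_ofNat] at h
  simp only [cosCos]
  linear_combination (1 / 2 * (Real.cos (j * z.1) : ℂ) * f z) * h

theorem integral_cos_int_mul (k : ℤ) :
    ∫ x in Ioc (-Real.pi) Real.pi, (Real.cos (k * x) : ℂ)
      = if k = 0 then 2 * (Real.pi : ℂ) else 0 := by
  rw [integral_complex_ofReal, ← intervalIntegral.integral_of_le (by linarith [Real.pi_pos])]
  split_ifs with h
  · simp [h]
    ring
  · have hk : (k : ℝ) ≠ 0 := by exact_mod_cast h
    rw [intervalIntegral.integral_comp_mul_left (fun x => Real.cos x) hk, integral_cos]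
    simp [Real.sin_int_mul_pi]

theorem cosCoeff_one (j k : ℤ) :
    cosCoeff j k 1 = if j = 0 ∧ k = 0 then 1 else 0 := by
  have hpi : (Real.pi : ℂ) ≠ 0 := by exact_mod_cast Real.pi_ne_zero
  have h := setIntegral_prod_mul (μ := (volume : Measure ℝ)) (ν := (volume : Measure ℝ))
    (fun y : ℝ => (Real.cos (j * y) : ℂ)) (fun x : ℝ => (Real.cos (k * x) : ℂ))
    (Ioc (-Real.pi) Real.pi) (Ioc (-Real.pi) Real.pi)
  rw [integral_cos_int_mul, integral_cos_int_mul] at h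
  simp only [cosCoeff, cosCos, Pi.one_apply, mul_one, square, Measure.volume_eq_prod, h]
  by_cases hj : j = 0 <;> by_cases hk : k = 0 <;> simp [hj, hk]
  field_simp
  norm_num

theorem cosCoeff_eq_intervalIntegral {f : ℝ × ℝ → ℂ} (hf : Continuous f) (j k : ℤ) :
    cosCoeff j k f = 1 / (4 * (Real.pi : ℂ) ^ 2) *
      ∫ y in (-Real.pi)..Real.pi, ∫ x in (-Real.pi)..Real.pi, cosCos j k (y, x) * f (y, x) := by
  have hle : -Real.pi ≤ Real.pi := by linarith [Real.pi_pos]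
  have hint : IntegrableOn (fun z => cosCos j k z * f z) square :=
    Continuous.integrableOn_square (by fun_prop)
  simp only [cosCoeff, intervalIntegral.integral_of_le hle]
  rw [square, Measure.volume_eq_prod] at *
  rw [setIntegral_prod _ hint]

/-- The exponential series may be summed under the integral sign: the norms of its terms add up to
a continuous function. -/
theorem hasSum_cosCoeff_exp {g : ℝ × ℝ → ℂ} (hg : Continuous g) (j k : ℤ) :
    HasSum (fun n : ℕ => (n ! : ℂ)⁻¹ * cosCoeff j k (g ^ n))
      (cosCoeff j k fun z => Complex.exp (g z)) := by
  have h : HasSum (fun n : ℕ => ∫ z in square, cosCos j k z * ((n ! : ℂ)⁻¹ * g z ^ n))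
      (∫ z in square, cosCos j k z * Complex.exp (g z)) := by
    refine hasSum_integral_of_dominated_convergence
      (fun n z => ‖cosCos j k z‖ * (‖g z‖ ^ n / n !)) (fun n => ?_) (fun n => ?_) ?_ ?_ ?_
    · exact Continuous.aestronglyMeasurable (by fun_prop)
    · refine Filter.Eventually.of_forall fun z => le_of_eq ?_
      simp [div_eq_inv_mul]
    · exact Filter.Eventually.of_forall fun z => (Real.summable_pow_div_factorial _).mul_left _
    · have h : (fun z => ∑' n : ℕ, ‖cosCos j k z‖ * (‖g z‖ ^ n / n !))
          = fun z => ‖cosCos j k z‖ * Real.exp ‖g z‖ := by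
        ext z
        rw [tsum_mul_left, Real.exp_eq_exp_ℝ, NormedSpace.exp_eq_tsum_div]
      rw [h]
      exact Continuous.integrableOn_square (by fun_prop)
    · refine Filter.Eventually.of_forall fun z => HasSum.mul_left _ ?_
      rw [Complex.exp_eq_exp_ℂ]
      simpa using NormedSpace.exp_series_hasSum_exp' (𝕂 := ℂ) (g z)
  refine (h.mul_left (1 / (4 * (Real.pi : ℂ) ^ 2))).congr_fun fun n => ?_
  simp only [mul_left_comm _ ((n ! : ℂ)⁻¹), integral_const_mul, cosCoeff, Pi.pow_apply]

/-! ### Symbols of operators -/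

/-- The operator `A` has the continuous function `f` as a cosine symbol: its matrix elements are
the cosine coefficients of `f`. (Only operators that are invariant under the reflections
`|k⟩ ↦ |-k⟩` on either side have one.) -/
structure HasSymbol (A : LineSpace →L[ℂ] LineSpace) (f : ℝ × ℝ → ℂ) : Prop where
  continuous : Continuous f
  inner_eq : ∀ j k : ℤ, ⟪ket j, A (ket k)⟫_ℂ = cosCoeff j k f

namespace HasSymbol

variable {A B : LineSpace →L[ℂ] LineSpace} {f g : ℝ × ℝ → ℂ}

theorem add (hA : HasSymbol A f) (hB : HasSymbol B g) : HasSymbol (A + B) (f + g) where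
  continuous := hA.continuous.add hB.continuous
  inner_eq j k := by
    rw [cosCoeff_add hA.continuous hB.continuous, ← hA.inner_eq, ← hB.inner_eq, add_apply,
      inner_add_right]

theorem smul (c : ℂ) (hA : HasSymbol A f) : HasSymbol (c • A) (c • f) where
  continuous := hA.continuous.const_smul c
  inner_eq j k := by
    rw [cosCoeff_smul, ← hA.inner_eq, smul_apply, inner_smul_right]

theorem dissipator_mul (hA : HasSymbol A f) :
    HasSymbol (lineDissipator * A) fun z => (Real.cos z.1 : ℂ) * f z where
  continuous := by
    have := hA.continuous
    fun_prop
  inner_eq j k := by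
    rw [← cosCoeff_row hA.continuous, ← hA.inner_eq, ← hA.inner_eq, mul_apply_eq_comp,
      inner_ket_lineDissipator]

theorem mul_dissipator (hA : HasSymbol A f) :
    HasSymbol (A * lineDissipator) fun z => (Real.cos z.2 : ℂ) * f z where
  continuous := by
    have := hA.continuous
    fun_prop
  inner_eq j k := by
    rw [← cosCoeff_column hA.continuous, ← hA.inner_eq, ← hA.inner_eq,
      mul_apply_eq_comp, lineDissipator_ket, map_smul, map_add, inner_smul_right,
      inner_add_right]

theorem ketbra_zero : HasSymbol (ketbra (ket 0) (ket 0)) 1 where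
  continuous := continuous_one
  inner_eq j k := by
    rw [cosCoeff_one, InnerProductSpace.rankOne_apply, inner_smul_right, inner_ket_ket,
      inner_ket_ket]
    by_cases hj : j = 0 <;> by_cases hk : k = 0 <;> simp [hj, hk, eq_comm]

/-- If a bounded map `G` on operators multiplies symbols by `g`, then `exp (t G)` multiplies them
by `exp (t g)`; only the symbol `1` is needed. -/
theorem linearFlow {G : (LineSpace →L[ℂ] LineSpace) →L[ℂ] (LineSpace →L[ℂ] LineSpace)}
    (hg : Continuous g) (hG : ∀ A f, HasSymbol A f → HasSymbol (G A) (g * f))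
    (hA : HasSymbol A 1) (t : ℝ) :
    HasSymbol (linearFlow G t A) fun z => Complex.exp ((t : ℂ) * g z) where
  continuous := by fun_prop
  inner_eq j k := by
    have hpow (n : ℕ) : HasSymbol ((G ^ n) A) (g ^ n) := by
      induction n with
      | zero => simpa using hA
      | succ n ih =>
        rw [pow_succ' G, pow_succ' g]
        exact hG _ _ ih
    have h := (innerSL ℂ (ket j)).hasSum ((ContinuousLinearMap.apply ℂ LineSpace (ket k)).hasSum
      (hasSum_linearFlow G t A))
    have hcoeff := hasSum_cosCoeff_exp (g := (t : ℂ) • g) (hg.const_smul _) j k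
    refine h.unique (hcoeff.congr_fun fun n => ?_)
    rw [smul_pow, ← ((hpow n).smul _).inner_eq]
    simp only [ContinuousLinearMap.apply_apply, innerSL_apply_apply, smul_apply, inner_smul_right]

end HasSymbol

/-- The function by which the generator of the walk multiplies symbols. -/
def walkSymbol (ω : ℝ) (z : ℝ × ℝ) : ℂ :=
  2 * Complex.I * (1 - (ω : ℂ)) * ((Real.cos z.2 : ℂ) - (Real.cos z.1 : ℂ))
    - (ω : ℂ) / 2 * ((Real.cos z.2 : ℂ) - (Real.cos z.1 : ℂ)) ^ 2

theorem continuous_walkSymbol (ω : ℝ) : Continuous (walkSymbol ω) := by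
  unfold walkSymbol
  fun_prop

theorem HasSymbol.gkslGenerator {A : LineSpace →L[ℂ] LineSpace} {f : ℝ × ℝ → ℂ} (ω : ℝ)
    (hA : HasSymbol A f) :
    HasSymbol (gkslGenerator lineHamiltonian lineDissipator ω A) (walkSymbol ω * f) := by
  have h := (((hA.dissipator_mul.add (hA.mul_dissipator.smul (-1))).smul
      (-Complex.I * (1 - (ω : ℂ)) * 2))).add
    ((hA.dissipator_mul.mul_dissipator.add
      ((hA.dissipator_mul.dissipator_mul.add hA.mul_dissipator.mul_dissipator).smul
        (-1 / 2))).smul (ω : ℂ))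
  convert h using 1
  · rw [gkslGenerator_apply, gksl, adjoint_lineDissipator, lineHamiltonian_eq_smul]
    simp only [smul_mul_assoc, mul_smul_comm, mul_assoc]
    module
  · ext z
    simp only [walkSymbol, Pi.mul_apply, Pi.add_apply, Pi.smul_apply, smul_eq_mul]
    ring

end StochasticWalk

end

theorem theorem3 (ω : ℝ) (hω : ω ∈ Set.Icc (0 : ℝ) 1) :
    (∃ ρ : ℝ → StochasticWalk.LineSpace →L[ℂ] StochasticWalk.LineSpace,
        StochasticWalk.IsLineWalk ω ρ) ∧
    ∀ ρ : ℝ → StochasticWalk.LineSpace →L[ℂ] StochasticWalk.LineSpace,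
      StochasticWalk.IsLineWalk ω ρ → ∀ t : ℝ, 0 ≤ t → ∀ k : ℤ,
        inner ℂ (StochasticWalk.ket k) (ρ t (StochasticWalk.ket k)) =
          1 / (4 * (Real.pi : ℂ) ^ 2) *
            ∫ y in (-Real.pi)..Real.pi, ∫ x in (-Real.pi)..Real.pi,
              (Real.cos (k * x) : ℂ) * (Real.cos (k * y) : ℂ)
                * Complex.exp (-(ω : ℂ) * ((t : ℂ) / 2)
                    * ((Real.cos x : ℂ) - (Real.cos y : ℂ)) ^ 2)
                * Complex.exp (2 * Complex.I * (t : ℂ) * (1 - (ω : ℂ))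
                    * ((Real.cos x : ℂ) - (Real.cos y : ℂ))) := by
  refine ⟨⟨fun t => StochasticWalk.linearFlow (StochasticWalk.gkslGenerator
      StochasticWalk.lineHamiltonian StochasticWalk.lineDissipator ω) t
      (StochasticWalk.ketbra (StochasticWalk.ket 0) (StochasticWalk.ket 0)),
    StochasticWalk.linearFlow_zero _ _, StochasticWalk.isGKSLSolution_linearFlow _ _ _ _⟩, ?_⟩
  intro ρ hρ t ht k
  have hsymb : StochasticWalk.HasSymbol (ρ t)
      fun z => Complex.exp ((t : ℂ) * StochasticWalk.walkSymbol ω z) := by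
    rw [hρ.evolution.eq_linearFlow ht, hρ.initial]
    exact StochasticWalk.HasSymbol.ketbra_zero.linearFlow
      (StochasticWalk.continuous_walkSymbol ω) (fun A f hA => hA.gkslGenerator ω) t
  rw [hsymb.inner_eq, StochasticWalk.cosCoeff_eq_intervalIntegral hsymb.continuous]
  congr 1
  refine intervalIntegral.integral_congr fun y _ => intervalIntegral.integral_congr fun x _ => ?_
  simp only [StochasticWalk.cosCos, StochasticWalk.walkSymbol]
  rw [mul_assoc _ (Complex.exp _) (Complex.exp _), ← Complex.exp_add,
    mul_comm (Real.cos (k * y) : ℂ)]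
  congr 2
  ring
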